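/- Let $\mathbb K$ be a field and let $\Gamma=(V,E)$ be a finite graph (loops and multiple edges allowed), with a fixed orientation of its edges. Let $H_1(\Gamma)=H_1(\Gamma,\mathbb K)$ be its cycle space, i.e. the kernel of the boundary map $\mathbb K^{E}\to\mathbb K^{V}$, $e\mapsto \mathrm{head}(e)-\mathrm{tail}(e)$, and let $b_1(\Gamma)=\dim_{\mathbb K} H_1(\Gamma)$. For $e\in E$ let $\eta_e:H_1(\Gamma)\to\mathbb K$ be the linear form that reads off the coefficient at $e$, and let $$\mathcal A_\Gamma=\{\operatorname{Ker}\eta_e \mid e\in E,\ \eta_e\neq 0\},$$ a finite set of hyperplanes in $H_1(\Gamma)$ (counted without multiplicity). Let $M(\mathcal A_\Gamma)$ be the complement of the union of these hyperplanes in the affine space $H_1(\Gamma)$, viewed as a variety over $\mathbb K$. Definitions. - An arrangement $\mathcal A$ is *Boolean* if the set of all intersections of subsets of $\mathcal A$ (the empty intersection being the whole space), ordered by reverse inclusion, is isomorphic to the lattice of all subsets of a finite set. - A *torification* of a scheme $X$ over $\mathbb Z$ is a morphism $T=\bigsqcup_j\mathbb G_m^{d_j}\to X$ from a disjoint union of split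 tori over $\mathbb Z$ whose restriction to each $\mathbb G_m^{d_j}$ is an isomorphism onto a locally closed subscheme of $X$ and which induces a bijection $T(L)\to X(L)$ for every field $L$. We say that $M(\mathcal A)$ *has a torification* if there is a scheme $X$ over $\mathbb Z$ that has a torification and such that $X\otimes\mathbb K\cong M(\mathcal A)$ over $\mathbb K$. - A *simple cycle* is a nonempty closed walk that passes each edge at most once; it defines an element of $H_1(\Gamma)$, the signed sum of its edges. A basis of $H_1(\Gamma)$ that consists of simple cycles is *separated* if no two distinct members share an edge. - A *spanning forest* is a set $\mathcal F\subset E$ of edges that consists of one spanning tree for each connected component of $\Gamma$. Its *fundamental basis* $\mathcal B(\mathcal F)$ consists of the simple cycles $C_e$, $e\in E\smallsetminus\mathcal F$, where $C_e$ is $e$ followed by the unique path in $\mathcal F$ from the head of $e$ to its tail. Then the following are equivalent: 1. $M(\mathcal A_\Gamma)$ has a torification; 2. $\mathcal A_\Gamma$ is Boolean; 3. $|\mathcal A_\Gamma|=b_1(\Gamma)$; 4. for every spanning forest $\mathcal F$ of $\Gamma$, the fundamental basis $\mathcal B(\mathcal F)$ is separated; 5. there exists a spanning forest $\mathcal F$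 of $\Gamma$ such that the fundamental basis $\mathcal B(\mathcal F)$ is separated; 6. there exists a separated basis of $H_1(\Gamma)$ consisting of simple cycles. -/

import Mathlib

open CategoryTheory CategoryTheory.Limits AlgebraicGeometry
open scoped Graph

universe u

noncomputable section

/-! ### Hyperplane arrangements -/

/-- A (central) hyperplane arrangement in the vector space `V`: a finite set of hyperplanes,
i.e. of linear subspaces of codimension one. -/
structure HypArr (K V : Type*) [Field K] [AddCommGroup V] [Module K V] where
  /-- the set of hyperplanes -/
  planes : Set (Submodule K V)
  finite_planes : planes.Finite
  isCoatom_of_mem : ∀ H ∈ planes, IsCoatom H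

namespace HypArr

section Lattice

variable {K V : Type*} [Field K] [AddCommGroup V] [Module K V]

/-- The underlying set of the intersection poset: all intersections of subsets of the arrangement
(the empty intersection being `V`; all of them contain `0`, so none is empty). -/
def flats (A : HypArr K V) : Set (Submodule K V) :=
  {X | ∃ S ⊆ A.planes, X = sInf S}

/-- The arrangement is Boolean: its intersection poset, ordered by reverse inclusion, is isomorphic
to the lattice of all subsets of a (finite) ground set. -/
def IsBoolean (A : HypArr K V) : Prop :=
  ∃ n : ℕ, Nonempty ((A.flats)ᵒᵈ ≃o Set (Fin n))

end Lattice

section Complement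

variable {K V : Type u} [Field K] [AddCommGroup V] [Module K V]

/-- The vector space `V` regarded as an affine scheme: the spectrum of the symmetric algebra of
the dual space, i.e. of the ring of polynomial functions on `V`. -/
abbrev affineSpace (K V : Type u) [Field K] [AddCommGroup V] [Module K V] : Scheme.{u} :=
  Spec (.of (SymmetricAlgebra K (Module.Dual K V)))

/-- The closed subset of the affine space `V` defined by the linear subspace `H`: the common zeros
of all linear forms that vanish on `H`. -/
def locus (H : Submodule K V) :
    Set (PrimeSpectrum (SymmetricAlgebra K (Module.Dual K V))) :=
  PrimeSpectrum.zeroLocus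
    ((SymmetricAlgebra.ι K (Module.Dual K V)) '' {φ | H ≤ LinearMap.ker φ})

/-- The complement of the union of the hyperplanes, as an open subset of the affine space. -/
def complementOpens (A : HypArr K V) : (affineSpace K V).Opens where
  carrier := (⋃ H ∈ A.planes, locus H)ᶜ
  is_open' := by
    have h : IsClosed (⋃ H ∈ A.planes, locus H) :=
      A.finite_planes.isClosed_biUnion fun H _ => PrimeSpectrum.isClosed_zeroLocus _
    exact h.isOpen_compl

/-- The complement `M(A)` as a variety over `K`: an open subscheme of the affine space. -/
abbrev complement (A : HypArr K V) : Scheme.{u} :=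
  (A.complementOpens : Scheme.{u})

/-- The structure morphism of `M(A)` over `Spec K`. -/
abbrev complementStr (A : HypArr K V) : A.complement ⟶ Spec (.of K) :=
  A.complementOpens.ι ≫
    Spec.map (CommRingCat.ofHom (algebraMap K (SymmetricAlgebra K (Module.Dual K V))))

end Complement

end HypArr

/-! ### Torifications -/

/-- The split torus of dimension `d` over `ℤ`: the spectrum of the ring of Laurent polynomials
with integer coefficients in `d` variables, i.e. of the group ring of `ℤ ^ d`. -/
abbrev splitTorus (d : ℕ) : Scheme.{u} :=
  Spec (.of (AddMonoidAlgebra (ULift.{u} ℤ) (Fin d → ℤ)))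

/-- A torification of a scheme `X` (over `ℤ`). -/
structure Torification (X : Scheme.{u}) where
  /-- the index set of the tori -/
  J : Type u
  /-- the dimensions of the tori -/
  dim : J → ℕ
  /-- the morphism from the disjoint union of the tori -/
  e : (∐ fun j => splitTorus.{u} (dim j)) ⟶ X
  /-- on each torus it is an isomorphism onto a locally closed subscheme -/
  isImmersion : ∀ j, IsImmersion (Sigma.ι (fun j => splitTorus.{u} (dim j)) j ≫ e)
  /-- it is bijective on `L`-valued points for every field `L` -/
  bijective : ∀ (L : Type u) [Field L],
    Function.Bijective
      fun p : Spec (.of L) ⟶ (∐ fun j => splitTorus.{u} (dim j)) => p ≫ e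

/-- The base change `X ⊗ K` of a scheme `X` over `ℤ` to `K`. -/
abbrev baseChange (X : Scheme.{u}) (K : Type u) [Field K] : Scheme.{u} :=
  pullback (specULiftZIsTerminal.{u}.from X) (specULiftZIsTerminal.{u}.from (Spec (.of K)))

/-- The structure morphism of `X ⊗ K` over `Spec K`. -/
abbrev baseChangeStr (X : Scheme.{u}) (K : Type u) [Field K] : baseChange X K ⟶ Spec (.of K) :=
  pullback.snd (specULiftZIsTerminal.{u}.from X) (specULiftZIsTerminal.{u}.from (Spec (.of K)))

/-- `M(A)` has a torification: there is a torified scheme `X` (over `ℤ`) such that `X ⊗ K` is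
isomorphic to `M(A)` over `K`. -/
def HypArr.HasTorification {K V : Type u} [Field K] [AddCommGroup V] [Module K V]
    (A : HypArr K V) : Prop :=
  ∃ X : Scheme.{u}, Nonempty (Torification X) ∧
    ∃ f : baseChange X K ≅ A.complement, f.hom ≫ A.complementStr = baseChangeStr X K

/-! ### Graphs: orientations, cycle space, and the associated arrangement -/

namespace Graph

/-- An orientation of a graph (loops and multiple edges are allowed): the choice, for each edge,
of which end is the tail and which is the head. -/
structure EdgeOrientation {α β : Type*} (Γ : Graph α β) where
  /-- the tail of an edge -/
  tail : E(Γ) → V(Γ)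
  /-- the head of an edge -/
  head : E(Γ) → V(Γ)
  isLink : ∀ e : E(Γ), Γ.IsLink (e : β) (tail e : α) (head e : α)

/-- Every graph can be oriented. -/
theorem nonempty_edgeOrientation {α β : Type*} (Γ : Graph α β) :
    Nonempty Γ.EdgeOrientation := by
  have h : ∀ e : E(Γ), ∃ p : V(Γ) × V(Γ), Γ.IsLink (e : β) (p.1 : α) (p.2 : α) := by
    intro e
    obtain ⟨x, y, hxy⟩ := (Γ.edge_mem_iff_exists_isLink e).1 e.2
    exact ⟨(⟨x, hxy.left_mem⟩, ⟨y, hxy.right_mem⟩), hxy⟩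
  choose p hp using h
  exact ⟨⟨fun e => (p e).1, fun e => (p e).2, hp⟩⟩

namespace EdgeOrientation

section CycleSpace

variable {α β : Type*} {Γ : Graph α β} (o : Γ.EdgeOrientation) (K : Type*) [Field K]

/-- The boundary map from 1-chains to 0-chains, `e ↦ head e - tail e`. -/
def boundary : (E(Γ) →₀ K) →ₗ[K] (V(Γ) →₀ K) :=
  Finsupp.linearCombination K
    fun e => Finsupp.single (o.head e) (1 : K) - Finsupp.single (o.tail e) (1 : K)

/-- The cycle space `H₁(Γ, K)`: since there are no 2-cells, it is the space of 1-cycles. -/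
abbrev H1 : Submodule K (E(Γ) →₀ K) :=
  LinearMap.ker (o.boundary K)

/-- The first Betti number. -/
def b1 : ℕ := Module.finrank K (o.H1 K)

/-- The linear form on `H₁(Γ, K)` given by the edge `e`: the coefficient at `e`. -/
def eta (e : E(Γ)) : o.H1 K →ₗ[K] K :=
  (Finsupp.lapply e : (E(Γ) →₀ K) →ₗ[K] K) ∘ₗ (o.H1 K).subtype

/-- The arrangement `A_Γ` of the kernels of the nonzero forms `η_e`, without multiplicities. -/
def arrangement [Finite E(Γ)] : HypArr K (o.H1 K) where
  planes := {H | ∃ e, o.eta K e ≠ 0 ∧ H = LinearMap.ker (o.eta K e)}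
  finite_planes :=
    (Set.finite_range fun e => LinearMap.ker (o.eta K e)).subset
      (by rintro H ⟨e, -, rfl⟩; exact ⟨e, rfl⟩)
  isCoatom_of_mem := by
    rintro H ⟨e, he, rfl⟩
    have hs : Function.Surjective (o.eta K e) := LinearMap.surjective he
    exact LinearMap.isCoatom_ker_of_surjective (R := K) (M := o.H1 K) (N := K) hs

end CycleSpace

/-! ### Walks, spanning forests and cycles -/

section Walks

variable {α β : Type*} {Γ : Graph α β} (o : Γ.EdgeOrientation)

/-- The starting vertex of a step: `(e, true)` traverses the edge `e` from tail to head and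
`(e, false)` traverses it from head to tail. -/
def src (d : E(Γ) × Bool) : V(Γ) := if d.2 then o.tail d.1 else o.head d.1

/-- The final vertex of a step. -/
def tgt (d : E(Γ) × Bool) : V(Γ) := if d.2 then o.head d.1 else o.tail d.1

/-- The list `l` of steps is a walk from `v` to `w`. -/
def IsWalk : V(Γ) → List (E(Γ) × Bool) → V(Γ) → Prop
  | v, [], w => v = w
  | v, d :: l, w => o.src d = v ∧ IsWalk (o.tgt d) l w

/-- The list `l` of steps is a path from `v` to `w`: a walk that visits no vertex twice. -/
def IsPath (v : V(Γ)) (l : List (E(Γ) × Bool)) (w : V(Γ)) : Prop :=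
  o.IsWalk v l w ∧ (v :: l.map o.tgt).Nodup

/-- The list `l` of steps is a simple cycle: a nonempty closed walk that passes each edge at most
once. -/
def IsSimpleCycle (l : List (E(Γ) × Bool)) : Prop :=
  l ≠ [] ∧ (∃ v, o.IsWalk v l v) ∧ (l.map Prod.fst).Nodup

/-- All steps of `l` use edges from `F`. -/
def UsesOnly (F : Set E(Γ)) (l : List (E(Γ) × Bool)) : Prop :=
  ∀ d ∈ l, d.1 ∈ F

/-- The set `F` of edges (together with all vertices) is a spanning forest: it contains no simple
cycle, and any two vertices that are joined by a walk in `Γ` are joined by a walk in `F`; in other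
words it consists of one spanning tree for each connected component of `Γ`. -/
def IsSpanningForest (F : Set E(Γ)) : Prop :=
  (∀ l, UsesOnly F l → ¬ o.IsSimpleCycle l) ∧
    ∀ v w, (∃ l, o.IsWalk v l w) → ∃ l, UsesOnly F l ∧ o.IsWalk v l w

variable (K : Type*) [Field K]

/-- The 1-chain of a list of steps: the signed sum of its edges. -/
def chain (l : List (E(Γ) × Bool)) : E(Γ) →₀ K :=
  (l.map fun d => Finsupp.single d.1 (if d.2 then (1 : K) else -1)).sum

/-- `B ⊆ H₁(Γ, K)` is a basis of `H₁(Γ, K)` that consists of (classes of) simple cycles. -/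
def IsSimpleCycleBasis (B : Set (o.H1 K)) : Prop :=
  LinearIndepOn K id B ∧ Submodule.span K B = ⊤ ∧
    ∀ z ∈ B, ∃ l, o.IsSimpleCycle l ∧ (z : E(Γ) →₀ K) = chain K l

/-- `B` is separated: no two distinct members share an edge. (A simple cycle passes each of its
edges exactly once, so its edges form the support of its chain.) -/
def IsSeparated (B : Set (o.H1 K)) : Prop :=
  ∀ z ∈ B, ∀ z' ∈ B, z ≠ z' →
    Disjoint (z : E(Γ) →₀ K).support (z' : E(Γ) →₀ K).support

/-- The fundamental basis of the spanning forest `F`: for each edge `e` outside `F`, the simple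
cycle that consists of `e` followed by the path in `F` from the head of `e` to its tail. -/
def fundamentalBasis (F : Set E(Γ)) : Set (o.H1 K) :=
  {z | ∃ e, e ∉ F ∧ ∃ l, UsesOnly F l ∧ o.IsPath (o.head e) l (o.tail e) ∧
    (z : E(Γ) →₀ K) = chain K ((e, true) :: l)}

end Walks

end EdgeOrientation

end Graph

end

/-! The hyperplanes of `o.arrangement K` meet in zero, so their defining forms span the dual of
`o.H1 K` and there are always at least b₁ of them. Each of the six conditions amounts to equality,
that is, to the forms being a basis of the dual.

Boolean: the intersection lattice is Boolean exactly when the forms are linearly independent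
(`linearIndependent_of_isBoolean`, `isBoolean_of_linearIndependent`).

Graphs: for a spanning forest `F`, the forms η_e with e ∉ F are dual to the fundamental basis and so
give b₁ distinct hyperplanes. If there are no others, every nonzero η_f is proportional to one of
these, so f lies on only one fundamental cycle (`isSeparated_fundamentalBasis`). Conversely, with
respect to a separated basis each nonzero η_f is a multiple of one coordinate form
(`ncard_planes_of_isSeparated`).

Torifications: if the forms are a basis, the complement is itself a split torus. Conversely, the
generic point of the complement, as a point over the function field, lifts to one torus of the
torification. Over K this torus, of dimension d, is immersed in the affine space and its ring embeds
in the function field, whence d ≤ b₁. The defining forms are units on it, hence monomials up to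
scalars; being pairwise non-associated primes, they have independent exponents in ℤ^d, so there are
at most d ≤ b₁ hyperplanes (`ncard_le_of_surjectiveOnStalks`). -/

namespace Graph.EdgeOrientation

/-! ### Walks, paths, reachability and spanning forests -/

section WalkLemmas

variable {α β : Type*} {Γ : Graph α β} {o : Γ.EdgeOrientation}

theorem IsWalk.append {u v w : V(Γ)} {l l' : List (E(Γ) × Bool)}
    (h : o.IsWalk u l v) (h' : o.IsWalk v l' w) : o.IsWalk u (l ++ l') w := by
  induction l generalizing u with
  | nil => obtain rfl : u = v := h; exact h'
  | cons d l ih => exact ⟨h.1, ih h.2⟩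

/-- The step in the opposite direction. -/
def flipStep (d : E(Γ) × Bool) : E(Γ) × Bool := (d.1, !d.2)

@[simp] theorem src_flipStep (d : E(Γ) × Bool) : o.src (flipStep d) = o.tgt d := by
  rcases d with ⟨e, _ | _⟩ <;> rfl

@[simp] theorem tgt_flipStep (d : E(Γ) × Bool) : o.tgt (flipStep d) = o.src d := by
  rcases d with ⟨e, _ | _⟩ <;> rfl

theorem isWalk_singleton (d : E(Γ) × Bool) : o.IsWalk (o.src d) [d] (o.tgt d) := ⟨rfl, rfl⟩

theorem IsWalk.reverse {v w : V(Γ)} {l : List (E(Γ) × Bool)} (h : o.IsWalk v l w) :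
    o.IsWalk w (l.map flipStep).reverse v := by
  induction l generalizing v with
  | nil => exact Eq.symm h
  | cons d l ih =>
    rw [List.map_cons, List.reverse_cons]
    refine (ih h.2).append ?_
    have := isWalk_singleton (o := o) (flipStep d)
    rwa [src_flipStep, tgt_flipStep, h.1] at this

theorem UsesOnly.reverse {F : Set E(Γ)} {l : List (E(Γ) × Bool)} (h : UsesOnly F l) :
    UsesOnly F (l.map flipStep).reverse := by
  intro d hd
  obtain ⟨d', hd', rfl⟩ := List.mem_map.1 (List.mem_reverse.1 hd)
  exact h d' hd'

theorem UsesOnly.append {F : Set E(Γ)} {l l' : List (E(Γ) × Bool)} (h : UsesOnly F l)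
    (h' : UsesOnly F l') : UsesOnly F (l ++ l') := by
  intro d hd
  rcases List.mem_append.1 hd with hd | hd
  exacts [h d hd, h' d hd]

theorem IsPath.of_cons {v w : V(Γ)} {d : E(Γ) × Bool} {l : List (E(Γ) × Bool)}
    (h : o.IsPath v (d :: l) w) : o.IsPath (o.tgt d) l w :=
  ⟨h.1.2, (List.nodup_cons.1 h.2).2⟩

/-- A vertex visited by a path splits off a final segment of the path. -/
theorem IsPath.exists_suffix {v w x : V(Γ)} {l : List (E(Γ) × Bool)} (h : o.IsPath v l w)
    (hx : x ∈ v :: l.map o.tgt) : ∃ l', l' <:+ l ∧ o.IsPath x l' w := by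
  induction l generalizing v with
  | nil =>
    obtain rfl : x = v := by simpa using hx
    exact ⟨[], List.suffix_rfl, h⟩
  | cons d l ih =>
    rcases List.mem_cons.1 hx with rfl | hx
    · exact ⟨d :: l, List.suffix_rfl, h⟩
    · obtain ⟨l', hl', hw⟩ := ih h.of_cons hx
      exact ⟨l', hl'.trans (List.suffix_cons d l), hw⟩

/-- Loop erasure from the back: a step is prepended to a path, unless its start is already visited,
in which case the path is cut down to its final segment from there. -/
theorem IsWalk.exists_isPath {F : Set E(Γ)} {v w : V(Γ)} {l : List (E(Γ) × Bool)}
    (h : o.IsWalk v l w) (hF : UsesOnly F l) : ∃ l', UsesOnly F l' ∧ o.IsPath v l' w := by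
  induction l generalizing v with
  | nil => exact ⟨[], hF, h, by simp⟩
  | cons d l ih =>
    obtain ⟨l', hF', hp⟩ := ih h.2 (fun x hx => hF x (List.mem_cons_of_mem _ hx))
    by_cases hv : v ∈ o.tgt d :: l'.map o.tgt
    · obtain ⟨l'', hs, hp'⟩ := hp.exists_suffix hv
      exact ⟨l'', fun x hx => hF' x (hs.subset hx), hp'⟩
    · refine ⟨d :: l', ?_, ⟨h.1, hp.1⟩, ?_⟩
      · intro x hx
        rcases List.mem_cons.1 hx with rfl | hx
        exacts [hF _ List.mem_cons_self, hF' x hx]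
      · rw [List.map_cons, List.nodup_cons]
        exact ⟨hv, hp.2⟩

theorem IsWalk.src_mem {v w : V(Γ)} {l : List (E(Γ) × Bool)} (h : o.IsWalk v l w)
    {d : E(Γ) × Bool} (hd : d ∈ l) : o.src d ∈ v :: l.map o.tgt := by
  induction l generalizing v with
  | nil => simp at hd
  | cons d' l ih =>
    rcases List.mem_cons.1 hd with rfl | hd
    · rw [h.1]; exact List.mem_cons_self
    · exact List.mem_cons_of_mem _ (ih h.2 hd)

/-- A path passes each edge at most once. -/
theorem IsPath.nodup_edges {v w : V(Γ)} {l : List (E(Γ) × Bool)} (h : o.IsPath v l w) :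
    (l.map Prod.fst).Nodup := by
  induction l generalizing v with
  | nil => simp
  | cons d l ih =>
    rw [List.map_cons, List.nodup_cons]
    refine ⟨fun hmem => ?_, ih h.of_cons⟩
    obtain ⟨d', hd', he⟩ := List.mem_map.1 hmem
    have hv : v ∉ (d :: l).map o.tgt := (List.nodup_cons.1 h.2).1
    have hsrc : o.src d = v := h.1.1
    have h1 : o.src d' ∈ (d :: l).map o.tgt := h.1.2.src_mem hd'
    have h2 : o.tgt d' ∈ (d :: l).map o.tgt := by
      rw [List.map_cons]; exact List.mem_cons_of_mem _ (List.mem_map_of_mem hd')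
    obtain ⟨e, b⟩ := d
    obtain ⟨e', b'⟩ := d'
    obtain rfl : e' = e := he
    rw [← hsrc] at hv
    -- Whatever its direction, a second passage of the edge starts or ends at `v`, which the rest of
    -- the path avoids.
    cases b <;> cases b' <;> first | exact hv h1 | exact hv h2

theorem UsesOnly.mono {F F' : Set E(Γ)} (hFF : F ⊆ F') {l : List (E(Γ) × Bool)}
    (h : UsesOnly F l) : UsesOnly F' l := fun d hd => hFF (h d hd)

theorem UsesOnly.cons {F : Set E(Γ)} {d : E(Γ) × Bool} {l : List (E(Γ) × Bool)} (hd : d.1 ∈ F)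
    (h : UsesOnly F l) : UsesOnly F (d :: l) := by
  intro x hx
  rcases List.mem_cons.1 hx with rfl | hx
  exacts [hd, h x hx]

/-- An edge closes a path that avoids it to a simple cycle. -/
theorem IsPath.isSimpleCycle_cons {e : E(Γ)} {F : Set E(Γ)} (he : e ∉ F)
    {l : List (E(Γ) × Bool)} (hl : UsesOnly F l) (h : o.IsPath (o.head e) l (o.tail e)) :
    o.IsSimpleCycle ((e, true) :: l) := by
  refine ⟨by simp, ⟨o.tail e, rfl, h.1⟩, ?_⟩
  rw [List.map_cons, List.nodup_cons]
  refine ⟨fun hm => ?_, h.nodup_edges⟩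
  obtain ⟨d, hd, hde⟩ := List.mem_map.1 hm
  have hde' : d.1 = e := hde
  exact he (hde' ▸ hl d hd)

/-- `w` can be reached from `v` by a walk in `F`. -/
def Reachable (o : Γ.EdgeOrientation) (F : Set E(Γ)) (v w : V(Γ)) : Prop :=
  ∃ l, UsesOnly F l ∧ o.IsWalk v l w

theorem Reachable.trans {F : Set E(Γ)} {u v w : V(Γ)} (h : o.Reachable F u v)
    (h' : o.Reachable F v w) : o.Reachable F u w := by
  obtain ⟨l, hl, hw⟩ := h
  obtain ⟨l', hl', hw'⟩ := h'
  exact ⟨l ++ l', hl.append hl', hw.append hw'⟩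

theorem Reachable.symm {F : Set E(Γ)} {v w : V(Γ)} (h : o.Reachable F v w) :
    o.Reachable F w v := by
  obtain ⟨l, hl, hw⟩ := h
  exact ⟨_, hl.reverse, hw.reverse⟩

theorem reachable_step {F : Set E(Γ)} {d : E(Γ) × Bool} (hd : d.1 ∈ F) :
    o.Reachable F (o.src d) (o.tgt d) :=
  ⟨[d], UsesOnly.cons hd (fun _ h => by simp at h), isWalk_singleton d⟩

/-- Each step is replaced by a detour in `F'`; this allows an edge of a cycle to be deleted. -/
theorem Reachable.of_steps {F F' : Set E(Γ)}
    (hF : ∀ d : E(Γ) × Bool, d.1 ∈ F → o.Reachable F' (o.src d) (o.tgt d)) {v w : V(Γ)}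
    (h : o.Reachable F v w) : o.Reachable F' v w := by
  obtain ⟨l, hl, hw⟩ := h
  induction l generalizing v with
  | nil => exact ⟨[], fun _ h => by simp at h, hw⟩
  | cons d l ih =>
    have h1 := hF d (hl d List.mem_cons_self)
    rw [hw.1] at h1
    exact h1.trans (ih (fun x hx => hl x (List.mem_cons_of_mem _ hx)) hw.2)

theorem exists_isSpanningForest [Finite E(Γ)] (o : Γ.EdgeOrientation) :
    ∃ F : Set E(Γ), o.IsSpanningForest F := by
  have hne : {F : Set E(Γ) | ∀ v w, (∃ l, o.IsWalk v l w) → o.Reachable F v w}.Nonempty :=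
    ⟨Set.univ, fun v w ⟨l, hl⟩ => ⟨l, fun _ _ => trivial, hl⟩⟩
  -- A minimal set of edges that preserves reachability is acyclic: an edge of a cycle could be
  -- bypassed along the rest of the cycle.
  obtain ⟨F, hF⟩ := (Set.toFinite _).exists_minimal hne
  refine ⟨F, fun l hl hc => ?_, hF.1⟩
  obtain ⟨hnil, ⟨v, hw⟩, hnd⟩ := hc
  obtain ⟨⟨e, b⟩, l, rfl⟩ := List.exists_cons_of_ne_nil hnil
  rw [List.map_cons, List.nodup_cons] at hnd
  have heF : e ∈ F := hl (e, b) List.mem_cons_self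
  have hback : o.Reachable (F \ {e}) (o.tgt (e, b)) (o.src (e, b)) := by
    refine ⟨l, fun d hd => ⟨hl d (List.mem_cons_of_mem _ hd), fun h => hnd.1 ?_⟩, ?_⟩
    · exact List.mem_map.2 ⟨d, hd, h⟩
    · rw [hw.1]; exact hw.2
  have hmem : F \ {e} ∈ {F : Set E(Γ) | ∀ v w, (∃ l, o.IsWalk v l w) → o.Reachable F v w} := by
    intro v w h
    refine (hF.1 v w h).of_steps fun d hd => ?_
    by_cases hde : d.1 = e
    · obtain ⟨e', b'⟩ := d
      obtain rfl : e' = e := hde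
      cases b <;> cases b' <;> first | exact hback | exact hback.symm
    · exact reachable_step ⟨hd, hde⟩
  exact (hF.2 hmem Set.sdiff_subset heF).2 rfl

end WalkLemmas

/-! ### Boundaries of chains -/

section Chains

variable {α β : Type*} {Γ : Graph α β} {o : Γ.EdgeOrientation} {K : Type*} [Field K]

theorem boundary_single (e : E(Γ)) (c : K) :
    o.boundary K (Finsupp.single e c) =
      c • (Finsupp.single (o.head e) (1 : K) - Finsupp.single (o.tail e) (1 : K)) := by
  simp [boundary]

theorem boundary_chain {v w : V(Γ)} {l : List (E(Γ) × Bool)} (h : o.IsWalk v l w) :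
    o.boundary K (chain K l) = Finsupp.single w (1 : K) - Finsupp.single v (1 : K) := by
  induction l generalizing v with
  | nil => obtain rfl : v = w := h; simp [chain]
  | cons d l ih =>
    have h1 := ih h.2
    have h2 := h.1
    unfold chain at h1 ⊢
    rw [List.map_cons, List.sum_cons, map_add, h1, boundary_single]
    obtain ⟨e, b⟩ := d
    cases b
    · have : o.head e = v := h2
      simp [tgt, this]
    · have : o.tail e = v := h2
      simp [tgt, this]

theorem chain_apply_of_usesOnly {F : Set E(Γ)} {l : List (E(Γ) × Bool)} (h : UsesOnly F l)
    {e : E(Γ)} (he : e ∉ F) : chain K l e = 0 := by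
  induction l with
  | nil => simp [chain]
  | cons d l ih =>
    have h1 := ih fun x hx => h x (List.mem_cons_of_mem _ hx)
    unfold chain at h1 ⊢
    have h2 : d.1 ≠ e := fun hde => he (hde ▸ h d List.mem_cons_self)
    rw [List.map_cons, List.sum_cons, Finsupp.add_apply, h1, Finsupp.single_eq_of_ne h2.symm,
      add_zero]

theorem chain_cons_true (e : E(Γ)) (l : List (E(Γ) × Bool)) :
    chain K ((e, true) :: l) = Finsupp.single e 1 + chain K l := by
  simp [chain]

/-- A 1-cycle supported in a set of edges without simple cycles is zero. -/
theorem eq_zero_of_acyclic {F : Set E(Γ)} (hF : ∀ l, UsesOnly F l → ¬ o.IsSimpleCycle l)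
    {z : E(Γ) →₀ K} (hz : o.boundary K z = 0) (hs : ∀ e ∉ F, z e = 0) : z = 0 := by
  classical
  ext e
  by_cases heF : e ∈ F
  swap
  · exact hs e heF
  -- `A` is the side of the head of `e` once `e` is deleted from `F`; acyclicity puts the tail on
  -- the other side. Pairing the boundary of `z` with the indicator of `A` kills every other edge of
  -- `F` and leaves `z e`.
  let A : Set V(Γ) := {v | o.Reachable (F \ {e}) (o.head e) v}
  have hhead : o.head e ∈ A := ⟨[], fun _ h => by simp at h, rfl⟩
  have htail : o.tail e ∉ A := by
    rintro ⟨l, hl, hw⟩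
    obtain ⟨l', hl', hp⟩ := hw.exists_isPath hl
    refine hF _ (UsesOnly.cons heF (hl'.mono Set.sdiff_subset))
      (hp.isSimpleCycle_cons (e := e) (by simp) hl')
  let χ : V(Γ) → K := fun v => if v ∈ A then 1 else 0
  let P : (V(Γ) →₀ K) →ₗ[K] K := Finsupp.linearCombination K χ
  have h0 : P (o.boundary K z) = 0 := by rw [hz, map_zero]
  have hP : ∀ f, P (o.boundary K (Finsupp.single f 1)) = χ (o.head f) - χ (o.tail f) := by
    intro f
    rw [boundary_single, one_smul, map_sub]
    simp [P]
  have hP' : ∀ f ∈ F, f ≠ e → χ (o.head f) = χ (o.tail f) := by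
    intro f hf hfe
    have h1 : o.head f ∈ A ↔ o.tail f ∈ A :=
      ⟨fun h => h.trans (reachable_step (d := (f, false)) ⟨hf, hfe⟩),
        fun h => h.trans (reachable_step (d := (f, true)) ⟨hf, hfe⟩)⟩
    simp only [χ, h1]
  have hsum : P (o.boundary K z) = z e := by
    conv_lhs => rw [← Finsupp.sum_single z]
    rw [Finsupp.sum, map_sum, map_sum, Finset.sum_eq_single e]
    · rw [← mul_one (z e), ← smul_eq_mul, ← Finsupp.smul_single, map_smul, map_smul, hP]
      simp [χ, hhead, htail]
    · intro f _ hfe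
      rw [← mul_one (z f), ← smul_eq_mul, ← Finsupp.smul_single, map_smul, map_smul, hP]
      by_cases hf : f ∈ F
      · rw [hP' f hf hfe, sub_self, smul_zero]
      · rw [hs f hf, zero_smul]
    · intro h
      rw [Finsupp.notMem_support_iff.1 h]; simp
  rw [← hsum, h0, Finsupp.zero_apply]

end Chains
end Graph.EdgeOrientation

namespace Graph.EdgeOrientation

/-! ### Fundamental bases and separated bases -/

section FundamentalBasis

variable {α β : Type*} {Γ : Graph α β} {o : Γ.EdgeOrientation} {K : Type*} [Field K]

@[simp] theorem eta_apply (e : E(Γ)) (z : o.H1 K) : o.eta K e z = (z : E(Γ) →₀ K) e := rfl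

theorem IsSpanningForest.ext_H1 {F : Set E(Γ)} (hF : o.IsSpanningForest F) {z z' : o.H1 K}
    (h : ∀ e ∉ F, (z : E(Γ) →₀ K) e = (z' : E(Γ) →₀ K) e) : z = z' := by
  rw [← sub_eq_zero]
  refine Subtype.ext (eq_zero_of_acyclic hF.1 (z - z').2 fun e he => ?_)
  simp [h e he]

theorem coeff_of_fundamental {F : Set E(Γ)} {e : E(Γ)} {l : List (E(Γ) × Bool)}
    (hl : UsesOnly F l) {f : E(Γ)} (hf : f ∉ F) :
    chain K ((e, true) :: l) f = Finsupp.single e (1 : K) f := by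
  rw [chain_cons_true, Finsupp.add_apply, chain_apply_of_usesOnly hl hf, add_zero]

/-- Edges of `F` are allowed too: for them the path runs back along `e` and the chain is zero. -/
theorem IsSpanningForest.exists_fundamental {F : Set E(Γ)} (hF : o.IsSpanningForest F)
    (K : Type*) [Field K] (e : E(Γ)) :
    ∃ (z : o.H1 K) (l : List (E(Γ) × Bool)), UsesOnly F l ∧
      o.IsPath (o.head e) l (o.tail e) ∧ (z : E(Γ) →₀ K) = chain K ((e, true) :: l) := by
  have h : o.Reachable F (o.head e) (o.tail e) :=
    hF.2 _ _ ⟨[(e, false)], isWalk_singleton (e, false)⟩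
  obtain ⟨l, hl, hw⟩ := h
  obtain ⟨l', hl', hp⟩ := hw.exists_isPath hl
  have hc : o.IsWalk (o.tail e) ((e, true) :: l') (o.tail e) := ⟨rfl, hp.1⟩
  refine ⟨⟨chain K ((e, true) :: l'), ?_⟩, l', hl', hp, rfl⟩
  rw [LinearMap.mem_ker, boundary_chain hc, sub_self]

/-- The fundamental basis of a spanning forest is a basis, dual to the coordinate forms of the
edges outside the forest. -/
theorem IsSpanningForest.exists_basis {F : Set E(Γ)} [Finite E(Γ)] (hF : o.IsSpanningForest F)
    (K : Type*) [Field K] :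
    ∃ b : Module.Basis (Fᶜ : Set E(Γ)) K (o.H1 K),
      (∀ e, ∀ f ∉ F, (b e : E(Γ) →₀ K) f = Finsupp.single (e : E(Γ)) (1 : K) f) ∧
      Set.range b = o.fundamentalBasis K F := by
  classical
  have := Fintype.ofFinite (Fᶜ : Set E(Γ))
  choose C l hl hp hC using fun e : E(Γ) => hF.exists_fundamental K e
  have hcoef : ∀ (e : E(Γ)) (f : E(Γ)), f ∉ F →
      (C e : E(Γ) →₀ K) f = Finsupp.single e (1 : K) f := by
    intro e f hf
    rw [hC, coeff_of_fundamental (hl e) hf]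
  have hd : Module.DualBases (fun e : (Fᶜ : Set E(Γ)) => C e)
      (fun e : (Fᶜ : Set E(Γ)) => o.eta K e) := by
    refine ⟨fun e => ?_, fun e f hef => ?_, fun h => hF.ext_H1 fun e he => h ⟨e, he⟩,
      fun _ => Set.toFinite _⟩
    · rw [eta_apply, hcoef _ _ e.2, Finsupp.single_eq_same]
    · change o.eta K e (C f) = 0
      rw [eta_apply, hcoef _ _ e.2, Finsupp.single_eq_of_ne]
      exact fun h => hef (Subtype.ext h)
  let b : Module.Basis (Fᶜ : Set E(Γ)) K (o.H1 K) := hd.basis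
  have hb : ∀ e, b e = C e := fun e => congrFun hd.coe_basis e
  refine ⟨b, fun e f hf => by rw [hb, hcoef _ _ hf], ?_⟩
  ext z
  constructor
  · rintro ⟨e, rfl⟩
    exact ⟨e, e.2, l e, hl e, hp e, by rw [hb, hC]⟩
  · rintro ⟨e, he, l', hl', -, hz⟩
    refine ⟨⟨e, he⟩, hF.ext_H1 fun f hf => ?_⟩
    rw [hb, hcoef _ _ hf, hz, coeff_of_fundamental hl' hf]

theorem IsSpanningForest.isSimpleCycleBasis [Finite E(Γ)] {F : Set E(Γ)}
    (hF : o.IsSpanningForest F) : o.IsSimpleCycleBasis K (o.fundamentalBasis K F) := by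
  obtain ⟨b, -, hb⟩ := hF.exists_basis K
  refine ⟨?_, ?_, ?_⟩
  · rw [← hb]
    exact b.linearIndependent.linearIndepOn_id
  · rw [← hb]
    exact b.span_eq
  · rintro z ⟨e, he, l, hl, hp, hz⟩
    exact ⟨_, hp.isSimpleCycle_cons he hl, hz⟩

/-- If there are only `b₁` hyperplanes then all fundamental bases are separated. -/
theorem isSeparated_fundamentalBasis [Finite E(Γ)]
    (h : (o.arrangement K).planes.ncard = o.b1 K) {F : Set E(Γ)} (hF : o.IsSpanningForest F) :
    o.IsSeparated K (o.fundamentalBasis K F) := by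
  classical
  have := Fintype.ofFinite (Fᶜ : Set E(Γ))
  obtain ⟨b, hcoef, hb⟩ := hF.exists_basis K
  have hδ : ∀ e f : (Fᶜ : Set E(Γ)), b e ∈ LinearMap.ker (o.eta K f) ↔ e ≠ f := by
    intro e f
    rw [LinearMap.mem_ker, eta_apply, hcoef _ _ f.2, Finsupp.single_apply]
    simp [Subtype.ext_iff]
  have hinj : Function.Injective fun e : (Fᶜ : Set E(Γ)) => LinearMap.ker (o.eta K e) := by
    intro e f hef
    by_contra hne
    have h1 := (hδ e f).2 hne
    have hef' : LinearMap.ker (o.eta K e) = LinearMap.ker (o.eta K f) := hef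
    rw [← hef', hδ] at h1
    exact h1 rfl
  -- The edges outside `F` already account for b₁ distinct hyperplanes, so by the count there are no
  -- others.
  have hplanes : Set.range (fun e : (Fᶜ : Set E(Γ)) => LinearMap.ker (o.eta K e)) =
      (o.arrangement K).planes := by
    refine Set.eq_of_subset_of_ncard_le ?_ ?_ (o.arrangement K).finite_planes
    · rintro _ ⟨e, rfl⟩
      refine ⟨e, fun h0 => ?_, rfl⟩
      have := (hδ e e).1 (by rw [h0]; simp)
      exact this rfl
    · rw [h, b1, Module.finrank_eq_card_basis b, ← Set.image_univ,
        Set.ncard_image_of_injective _ hinj, Set.ncard_univ, Nat.card_eq_fintype_card]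
  rw [← hb]
  rintro _ ⟨e, rfl⟩ _ ⟨e', rfl⟩ hne
  rw [Finset.disjoint_left]
  intro f hf hf'
  rw [Finsupp.mem_support_iff] at hf hf'
  have hmem : LinearMap.ker (o.eta K f) ∈ (o.arrangement K).planes :=
    ⟨f, fun h0 => hf (by rw [← eta_apply, h0]; rfl), rfl⟩
  rw [← hplanes] at hmem
  obtain ⟨g, hg⟩ := hmem
  have hg' : LinearMap.ker (o.eta K g) = LinearMap.ker (o.eta K f) := hg
  -- Among the basis cycles only `b g` lies off the kernel of `o.eta K g`, which is also that of
  -- `o.eta K f`.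
  have h1 : e = g := by
    by_contra hc
    have := (hδ e g).2 hc
    rw [hg'] at this
    exact hf this
  have h2 : e' = g := by
    by_contra hc
    have := (hδ e' g).2 hc
    rw [hg'] at this
    exact hf' this
  exact hne (by rw [h1, h2])

/-- A separated basis forces the hyperplanes to be the coordinate hyperplanes of that basis. -/
theorem ncard_planes_of_isSeparated [Finite E(Γ)] {B : Set (o.H1 K)}
    (hB : o.IsSimpleCycleBasis K B) (hs : o.IsSeparated K B) :
    (o.arrangement K).planes.ncard = o.b1 K := by
  classical
  let b : Module.Basis B K (o.H1 K) := Module.Basis.mk (v := fun z : B => (z : o.H1 K)) hB.1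
    (by rw [Subtype.range_coe]; exact hB.2.1.ge)
  have hb : ∀ z : B, b z = z := fun z => Module.Basis.mk_apply _ _ z
  have hker : ∀ (z : B) (f : E(Γ)), ((z : o.H1 K) : E(Γ) →₀ K) f ≠ 0 →
      LinearMap.ker (o.eta K f) = LinearMap.ker (b.coord z) := by
    intro z f hf
    -- By separatedness `z` is the only basis member that contains `f`.
    have : o.eta K f = ((z : o.H1 K) : E(Γ) →₀ K) f • b.coord z := by
      refine b.ext fun z' => ?_
      rw [LinearMap.smul_apply, Module.Basis.coord_apply, Module.Basis.repr_self, hb, eta_apply]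
      by_cases hz : z' = z
      · subst hz; simp
      · have hd := hs z z.2 z' z'.2 (fun h => hz (Subtype.ext h.symm))
        have hf' := Finset.disjoint_left.1 hd (Finsupp.mem_support_iff.2 hf)
        rw [Finsupp.notMem_support_iff.1 hf', Finsupp.single_eq_of_ne (Ne.symm hz), smul_zero]
    rw [this, LinearMap.ker_smul _ _ hf]
  have hinj : Function.Injective fun z : B => LinearMap.ker (b.coord z) := by
    intro z z' h
    by_contra hne
    have h1 : b z ∈ LinearMap.ker (b.coord z') := by
      rw [LinearMap.mem_ker, Module.Basis.coord_apply, Module.Basis.repr_self,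
        Finsupp.single_eq_of_ne (Ne.symm hne)]
    have h' : LinearMap.ker (b.coord z) = LinearMap.ker (b.coord z') := h
    rw [← h', LinearMap.mem_ker, Module.Basis.coord_apply, Module.Basis.repr_self] at h1
    simp at h1
  have hplanes : (o.arrangement K).planes = Set.range fun z : B => LinearMap.ker (b.coord z) := by
    ext H
    constructor
    · rintro ⟨f, hf, rfl⟩
      have : ∃ z : B, ((z : o.H1 K) : E(Γ) →₀ K) f ≠ 0 := by
        by_contra! hc
        refine hf (b.ext fun z => ?_)
        rw [hb, eta_apply, hc z]; rfl
      obtain ⟨z, hz⟩ := this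
      exact ⟨z, (hker z f hz).symm⟩
    · rintro ⟨z, rfl⟩
      have hz0 : ((z : o.H1 K) : E(Γ) →₀ K) ≠ 0 := by
        rw [← hb z]
        exact fun h => b.ne_zero z (Subtype.ext h)
      obtain ⟨f, hf⟩ := Finsupp.ne_iff.1 hz0
      exact ⟨f, fun h0 => hf (by rw [← eta_apply, h0]; rfl), (hker z f hf).symm⟩
  rw [hplanes, ← Set.image_univ, Set.ncard_image_of_injective _ hinj, Set.ncard_univ, b1,
    Module.finrank_eq_nat_card_basis b]

/-- The hyperplanes of the arrangement of a graph intersect in zero. -/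
theorem sInf_planes_arrangement [Finite E(Γ)] : sInf (o.arrangement K).planes = ⊥ := by
  rw [eq_bot_iff]
  intro z hz
  rw [Submodule.mem_sInf] at hz
  refine (Submodule.mem_bot K).2 (Subtype.ext (Finsupp.ext fun e => ?_))
  by_cases h : o.eta K e = 0
  · rw [← eta_apply, h]; rfl
  · exact hz _ ⟨e, h, rfl⟩

end FundamentalBasis

end Graph.EdgeOrientation

namespace HypArr

/-! ### Boolean arrangements and independence of the defining forms -/

section Essential

variable {K V : Type*} [Field K] [AddCommGroup V] [Module K V]

/-- A linear form with a given hyperplane as its kernel. -/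
theorem exists_ker_eq_of_isCoatom {H : Submodule K V} (hH : IsCoatom H) :
    ∃ φ : Module.Dual K V, φ ≠ 0 ∧ LinearMap.ker φ = H := by
  obtain ⟨φ, hφ, hle⟩ := Submodule.exists_le_ker_of_lt_top H hH.lt_top
  refine ⟨φ, hφ, ?_⟩
  rcases hH.le_iff.1 hle with h | h
  · exact absurd (LinearMap.ker_eq_top.1 h) hφ
  · exact h

/-- A defining linear form of a member of the arrangement. -/
noncomputable def form (A : HypArr K V) (H : A.planes) : Module.Dual K V :=
  (exists_ker_eq_of_isCoatom (A.isCoatom_of_mem H H.2)).choose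

theorem form_ne_zero (A : HypArr K V) (H : A.planes) : A.form H ≠ 0 :=
  (exists_ker_eq_of_isCoatom (A.isCoatom_of_mem H H.2)).choose_spec.1

@[simp] theorem ker_form (A : HypArr K V) (H : A.planes) : LinearMap.ker (A.form H) = H :=
  (exists_ker_eq_of_isCoatom (A.isCoatom_of_mem H H.2)).choose_spec.2

variable {A : HypArr K V}

/-- Hyperplanes correspond to singletons. The flat corresponding to the complement of one singleton
lies in every other hyperplane but not in this one, so this form is not in the span of the others.
-/
theorem linearIndependent_of_isBoolean (hA : A.IsBoolean) : LinearIndependent K A.form := by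
  obtain ⟨n, ⟨e⟩⟩ := hA
  have htop : (⊤ : Submodule K V) ∈ A.flats := ⟨∅, Set.empty_subset _, sInf_empty.symm⟩
  have hmem : ∀ H ∈ A.planes, H ∈ A.flats := fun H hH =>
    ⟨{H}, Set.singleton_subset_iff.2 hH, sInf_singleton.symm⟩
  let E : A.flats → Set (Fin n) := fun X => e (OrderDual.toDual X)
  have hE : ∀ X Y : A.flats, E X ≤ E Y ↔ (Y : Submodule K V) ≤ X := fun X Y =>
    e.le_iff_le.trans Iff.rfl
  have hsurj : ∀ s, ∃ X, E X = s := fun s => ⟨OrderDual.ofDual (e.symm s), e.apply_symm_apply s⟩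
  have hatom : ∀ H : A.planes, ∃ i, E ⟨H, hmem H H.2⟩ = {i} := by
    intro H
    have hco := A.isCoatom_of_mem H H.2
    have hne : (E ⟨H, hmem H H.2⟩).Nonempty := by
      rw [Set.nonempty_iff_ne_empty]
      intro h0
      have : E ⟨H, hmem H H.2⟩ ≤ E ⟨⊤, htop⟩ := by rw [h0]; exact Set.empty_subset _
      exact hco.1 (top_le_iff.1 ((hE _ _).1 this))
    obtain ⟨i, hi⟩ := hne
    obtain ⟨X, hX⟩ := hsurj {i}
    have hle : E X ≤ E ⟨H, hmem H H.2⟩ := by rw [hX]; exact Set.singleton_subset_iff.2 hi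
    refine ⟨i, ?_⟩
    -- The flat of `{i}` contains the coatom `H`; it is not the whole space, because that one
    -- corresponds to the empty set.
    rcases hco.le_iff.1 ((hE _ _).1 hle) with h | h
    · obtain ⟨Y, hY⟩ := hsurj ∅
      have : E X ≤ E Y := (hE _ _).2 (by rw [h]; exact le_top)
      rw [hX, hY] at this
      exact absurd (this (Set.mem_singleton i)) (Set.notMem_empty i)
    · rw [← hX]
      exact congrArg E (Subtype.ext h.symm)
  choose i hi using hatom
  have hiinj : Function.Injective i := by
    intro H H' h
    have h1 : E ⟨H, hmem H H.2⟩ = E ⟨H', hmem H' H'.2⟩ := by rw [hi, hi, h]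
    exact Subtype.ext (le_antisymm ((hE _ _).1 h1.ge) ((hE _ _).1 h1.le))
  rw [linearIndependent_iff_notMem_span]
  intro H hH
  obtain ⟨Y, hY⟩ := hsurj {i H}ᶜ
  have hYle : ∀ H' : A.planes, H' ≠ H → (Y : Submodule K V) ≤ H' := by
    intro H' hne
    refine (hE ⟨H', hmem H' H'.2⟩ Y).1 ?_
    rw [hi, hY, Set.singleton_subset_iff]
    exact fun h => hne (hiinj h)
  have hYH : (Y : Submodule K V) ≤ H := by
    intro y hy
    rw [← ker_form A H, LinearMap.mem_ker]
    have hspan : Submodule.span K (A.form '' (Set.univ \ {H})) ≤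
        LinearMap.ker (Module.Dual.eval K V y) := by
      rw [Submodule.span_le]
      rintro _ ⟨H', hH', rfl⟩
      have := hYle H' hH'.2 hy
      rw [← ker_form A H', LinearMap.mem_ker] at this
      exact this
    exact hspan hH
  have := (hE ⟨H, hmem H H.2⟩ Y).2 hYH
  rw [hi, hY] at this
  exact this (Set.mem_singleton _) rfl

variable [FiniteDimensional K V]

theorem span_form_eq_top (h : sInf A.planes = ⊥) : Submodule.span K (Set.range A.form) = ⊤ := by
  rw [eq_top_iff]
  intro φ _
  refine FiniteDimensional.mem_span_of_iInf_ker_le_ker (le_trans ?_ bot_le)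
  rw [← h]
  exact le_sInf fun H hH => (iInf_le _ ⟨H, hH⟩).trans (ker_form A ⟨H, hH⟩).le

theorem finrank_le_ncard (h : sInf A.planes = ⊥) : Module.finrank K V ≤ A.planes.ncard := by
  have := A.finite_planes.fintype
  rw [← Subspace.dual_finrank_eq, ← finrank_top, ← span_form_eq_top h, ← Nat.card_coe_set_eq,
    Nat.card_eq_fintype_card]
  exact finrank_range_le_card _

/-- An essential arrangement with as many hyperplanes as dimensions is given by the coordinate
forms of a basis. -/
noncomputable def formBasis (h : sInf A.planes = ⊥) (hc : A.planes.ncard = Module.finrank K V) :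
    Module.Basis A.planes K (Module.Dual K V) :=
  have := A.finite_planes.fintype
  basisOfTopLeSpanOfCardEqFinrank A.form (span_form_eq_top h).ge (by
    rw [← Nat.card_eq_fintype_card, Nat.card_coe_set_eq, hc, Subspace.dual_finrank_eq])

theorem formBasis_apply (h : sInf A.planes = ⊥) (hc : A.planes.ncard = Module.finrank K V)
    (H : A.planes) : formBasis h hc H = A.form H := by
  simp [formBasis]

/-- A form that vanishes on the intersection of `S` is in the span of the forms of `S`, so
independence lets a set of hyperplanes be recovered from its intersection. -/
theorem mem_of_sInf_le (hA : LinearIndependent K A.form) {S : Set (Submodule K V)}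
    (hS : S ⊆ A.planes) {H : Submodule K V} (hH : H ∈ A.planes) (hle : sInf S ≤ H) : H ∈ S := by
  have hspan : A.form ⟨H, hH⟩ ∈
      Submodule.span K (Set.range fun H' : S => A.form ⟨H', hS H'.2⟩) := by
    refine FiniteDimensional.mem_span_of_iInf_ker_le_ker (le_trans ?_ (hle.trans
      (ker_form A ⟨H, hH⟩).ge))
    exact le_sInf fun H' hH' => (iInf_le _ ⟨H', hH'⟩).trans (ker_form A ⟨H', hS hH'⟩).le
  have himg : (Set.range fun H' : S => A.form ⟨H', hS H'.2⟩) =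
      A.form '' {H' : A.planes | (H' : Submodule K V) ∈ S} := by
    ext φ
    constructor
    · rintro ⟨H', rfl⟩
      exact ⟨_, H'.2, rfl⟩
    · rintro ⟨H', hH', rfl⟩
      exact ⟨⟨H', hH'⟩, rfl⟩
  rw [himg] at hspan
  by_contra hc
  exact hA.notMem_span_image (s := {H' : A.planes | (H' : Submodule K V) ∈ S})
    (x := ⟨H, hH⟩) hc hspan

theorem isBoolean_of_linearIndependent (hA : LinearIndependent K A.form) : A.IsBoolean := by
  have := A.finite_planes.fintype
  refine ⟨Fintype.card A.planes, ⟨OrderIso.symm ?_⟩⟩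
  refine OrderIso.trans (Fintype.equivFin A.planes).symm.toOrderIsoSet ?_
  have hsub : ∀ s : Set A.planes, Subtype.val '' s ⊆ A.planes := by
    rintro s _ ⟨H, -, rfl⟩
    exact H.2
  let g : Set A.planes → (A.flats)ᵒᵈ := fun s =>
    OrderDual.toDual ⟨sInf (Subtype.val '' s), _, hsub s, rfl⟩
  have hg : ∀ s t, g s ≤ g t ↔ s ≤ t := by
    intro s t
    constructor
    · intro hst H hH
      have hle : sInf (Subtype.val '' t) ≤ (H : Submodule K V) :=
        le_trans hst (sInf_le ⟨H, hH, rfl⟩)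
      obtain ⟨H', hH', he⟩ := mem_of_sInf_le hA (hsub t) H.2 hle
      rwa [← Subtype.ext he]
    · intro hst
      exact sInf_le_sInf (α := Submodule K V) (Set.image_mono hst)
  refine RelIso.ofSurjective (OrderEmbedding.ofMapLEIff g hg) ?_
  rintro ⟨X, S, hS, rfl⟩
  refine ⟨{H | (H : Submodule K V) ∈ S}, ?_⟩
  have himg : Subtype.val '' {H : A.planes | (H : Submodule K V) ∈ S} = S := by
    ext H
    constructor
    · rintro ⟨H', hH', rfl⟩
      exact hH'
    · exact fun hH => ⟨⟨H, hS hH⟩, hH, rfl⟩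
  exact congrArg OrderDual.toDual (Subtype.ext (congrArg sInf himg))

theorem isBoolean_iff (h : sInf A.planes = ⊥) :
    A.IsBoolean ↔ A.planes.ncard = Module.finrank K V := by
  constructor
  · intro hA
    have := A.finite_planes.fintype
    refine le_antisymm ?_ (finrank_le_ncard h)
    have := (linearIndependent_of_isBoolean hA).fintype_card_le_finrank
    rwa [Subspace.dual_finrank_eq, ← Nat.card_eq_fintype_card, Nat.card_coe_set_eq] at this
  · intro hc
    refine isBoolean_of_linearIndependent ?_
    rw [← funext (formBasis_apply h hc)]
    exact (formBasis h hc).linearIndependent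

end Essential

end HypArr

/-! ### Units of Laurent polynomial rings and independence of exponents -/

section MonoidAlgebraUnits

variable {K : Type*} [Field K]

/-- The units of the group algebra of `G` are monomials, if `G` has two unique sums. -/
theorem AddMonoidAlgebra.exists_eq_single_of_isUnit {G : Type*} [AddCommGroup G] [TwoUniqueSums G]
    {x : AddMonoidAlgebra K G} (hx : IsUnit x) : ∃ a c, c ≠ 0 ∧ x = single a c := by
  obtain ⟨y, hxy⟩ := hx.exists_right_inv
  have hx0 : x ≠ 0 := left_ne_zero_of_mul_eq_one hxy
  have hy0 : y ≠ 0 := right_ne_zero_of_mul_eq_one hxy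
  have hxs : x.coeff.support.Nonempty := by
    rwa [Finsupp.support_nonempty_iff, ne_eq, coeff_eq_zero]
  have hys : y.coeff.support.Nonempty := by
    rwa [Finsupp.support_nonempty_iff, ne_eq, coeff_eq_zero]
  -- Otherwise two different pairs of exponents have unique sums. At a unique sum the coefficient of
  -- `x * y = 1` is nonzero, so both sums are 0, contradicting uniqueness.
  have hcard : x.coeff.support.card * y.coeff.support.card ≤ 1 := by
    by_contra! h
    obtain ⟨p, hp, q, hq, hne, hpu, hqu⟩ := TwoUniqueSums.uniqueAdd_of_one_lt_card h
    rw [Finset.mem_product] at hp hq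
    have key : ∀ r : G × G, r.1 ∈ x.coeff.support → r.2 ∈ y.coeff.support →
        UniqueAdd x.coeff.support y.coeff.support r.1 r.2 → r.1 + r.2 = 0 := by
      intro r h1 h2 hr
      by_contra h0
      have := coeff_mul_add_of_uniqueAdd hr
      rw [hxy, one_def, coeff_single, Finsupp.single_eq_of_ne h0] at this
      exact mul_ne_zero (Finsupp.mem_support_iff.1 h1) (Finsupp.mem_support_iff.1 h2) this.symm
    have h1 := key p hp.1 hp.2 hpu
    have h2 := key q hq.1 hq.2 hqu
    obtain ⟨e1, e2⟩ := hpu hq.1 hq.2 (h2.trans h1.symm)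
    exact hne (Prod.ext e1.symm e2.symm)
  have hx1 : x.coeff.support.card = 1 := by
    refine le_antisymm ?_ hxs.card_pos
    exact (Nat.le_mul_of_pos_right _ hys.card_pos).trans hcard
  obtain ⟨a, ha⟩ := Finset.card_eq_one.1 hx1
  obtain ⟨hne, heq⟩ := Finsupp.support_eq_singleton.1 ha
  exact ⟨a, x.coeff a, hne, coeff_injective heq⟩

/-- Pairwise non-associated primes that become monomials in the Laurent polynomial ring have
independent exponents. -/
theorem linearIndependent_exponents {S G ι : Type*} [CommRing S] [Algebra K S]
    [AddCommGroup G] [Fintype ι] (ψ : S →ₐ[K] AddMonoidAlgebra K G)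
    (hψ : Function.Injective ψ) {p : ι → S} (hp : ∀ i, Prime (p i))
    (hpp : ∀ i j, p i ∣ p j → i = j) {a : ι → G} {c : ι → K} (hc : ∀ i, c i ≠ 0)
    (h : ∀ i, ψ (p i) = AddMonoidAlgebra.single (a i) (c i)) : LinearIndependent ℤ a := by
  have hprod : ∀ n : ι → ℕ, ψ (∏ i, p i ^ n i) =
      AddMonoidAlgebra.single (∑ i, n i • a i) (∏ i, c i ^ n i) := by
    intro n
    rw [map_prod, ← AddMonoidAlgebra.prod_single]
    refine Finset.prod_congr rfl fun i _ => ?_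
    rw [map_pow, h, AddMonoidAlgebra.single_pow]
  -- Splitting `n` into positive and negative parts turns the relation into an equality, up to the
  -- scalar `C`, of two products of the primes. If `n i > 0`, then `p i` divides the left one, hence
  -- some `p j` with `n j < 0`, although that forces `j = i`.
  have key : ∀ n : ι → ℤ, ∑ i, n i • a i = 0 → ∀ i, n i ≤ 0 := by
    intro n hn i
    by_contra! hi
    have hsum : ∑ i, (n i).toNat • a i = ∑ i, (-n i).toNat • a i := by
      rw [← sub_eq_zero, ← Finset.sum_sub_distrib, ← hn]
      refine Finset.sum_congr rfl fun i _ => ?_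
      rw [← natCast_zsmul, ← natCast_zsmul, ← sub_smul, Int.toNat_sub_toNat_neg]
    have hne : ∀ m : ι → ℕ, ∏ i, c i ^ m i ≠ 0 := fun m =>
      Finset.prod_ne_zero_iff.2 fun i _ => pow_ne_zero _ (hc i)
    set C := (∏ i, c i ^ (n i).toNat) * (∏ i, c i ^ (-n i).toNat)⁻¹ with hC
    have heq : ∏ i, p i ^ (n i).toNat = C • ∏ i, p i ^ (-n i).toNat := by
      apply hψ
      rw [map_smul, hprod, hprod, hsum, AddMonoidAlgebra.smul_single, smul_eq_mul, hC,
        inv_mul_cancel_right₀ (hne _)]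
    have hdvd : p i ∣ C • ∏ i, p i ^ (-n i).toNat := by
      rw [← heq]
      exact (dvd_pow_self _ (by omega)).trans (Finset.dvd_prod_of_mem _ (Finset.mem_univ i))
    rw [Algebra.smul_def] at hdvd
    rcases (hp i).dvd_or_dvd hdvd with h1 | h1
    · refine (hp i).not_isUnit (isUnit_of_dvd_unit h1 ?_)
      exact (IsUnit.mk0 C (mul_ne_zero (hne _) (inv_ne_zero (hne _)))).map _
    · obtain ⟨j, -, hj⟩ := (hp i).exists_mem_finset_dvd h1
      by_cases h0 : (-n j).toNat = 0
      · rw [h0, pow_zero] at hj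
        exact (hp i).not_isUnit (isUnit_of_dvd_one hj)
      · obtain rfl := hpp i j ((hp i).dvd_of_dvd_pow hj)
        omega
  rw [Fintype.linearIndependent_iff]
  intro n hn i
  refine le_antisymm (key n hn i) ?_
  have := key (-n) (by simpa using hn) i
  simpa using this

end MonoidAlgebraUnits

/-! ### Polynomial functions on a vector space and the dimension bound -/

namespace SymmetricAlgebra

variable {K W : Type*} [Field K] [AddCommGroup W] [Module K W]

/-- Extending `w` to a basis makes it a variable of a polynomial ring. -/
theorem prime_ι {w : W} (hw : w ≠ 0) : Prime (ι K W w) := by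
  have hli : LinearIndepOn K id {w} := LinearIndepOn.singleton hw
  let b := Module.Basis.extend hli
  have hmem : w ∈ hli.extend (Set.subset_univ _) :=
    hli.subset_extend (Set.subset_univ _) rfl
  have hb : b ⟨w, hmem⟩ = w := Module.Basis.extend_apply_self hli ⟨w, hmem⟩
  have hX := equivMvPolynomial_ι_apply b ⟨w, hmem⟩
  rw [hb] at hX
  rw [← MulEquiv.prime_iff (equivMvPolynomial b), hX]
  exact MvPolynomial.X_prime

theorem trdeg_eq_finrank [FiniteDimensional K W] :
    Algebra.trdeg K (SymmetricAlgebra K W) = Module.finrank K W := by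
  have b := Module.finBasis K W
  rw [← Cardinal.lift_inj, (equivMvPolynomial b).lift_trdeg_eq]
  simp

end SymmetricAlgebra

/-- The Laurent polynomial ring in `d` variables contains the polynomial ring. -/
theorem exists_mvPolynomial_injective (K : Type*) [Field K] (d : ℕ) :
    ∃ f : MvPolynomial (Fin d) K →ₐ[K] AddMonoidAlgebra K (Fin d → ℤ), Function.Injective f := by
  let g : (Fin d →₀ ℕ) →+ (Fin d → ℤ) :=
    { toFun := fun a i => (a i : ℤ)
      map_zero' := by ext; simp
      map_add' := fun a b => by ext; simp }
  have hg : Function.Injective g := fun a b h => Finsupp.ext fun i => by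
    exact Int.ofNat_inj.1 (congrFun h i)
  exact ⟨AddMonoidAlgebra.mapDomainAlgHom K K g, AddMonoidAlgebra.mapDomain_injective hg⟩

namespace HypArr

variable {K V : Type*} [Field K] [AddCommGroup V] [Module K V] 

/-- Evaluation at vectors turns divisibility into inclusion of kernels, and coatoms are
incomparable. -/
theorem eq_of_ι_dvd_ι (A : HypArr K V) {H H' : A.planes}
    (h : SymmetricAlgebra.ι K _ (A.form H) ∣ SymmetricAlgebra.ι K _ (A.form H')) : H = H' := by
  have hle : (H : Submodule K V) ≤ H' := by
    intro v hv
    rw [← ker_form A, LinearMap.mem_ker] at hv ⊢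
    have := map_dvd (SymmetricAlgebra.lift (Module.Dual.eval K V v)) h
    rw [SymmetricAlgebra.lift_ι_apply, SymmetricAlgebra.lift_ι_apply, Module.Dual.eval_apply,
      Module.Dual.eval_apply, hv] at this
    exact zero_dvd_iff.1 this
  rcases (A.isCoatom_of_mem H H.2).le_iff.1 hle with h' | h'
  · exact absurd h' (A.isCoatom_of_mem H' H'.2).1
  · exact Subtype.ext h'.symm

/-- If a torus is locally closed in the affine space `V`, contains the generic point, and lies in
the complement of the arrangement, then there are at most `dim V` hyperplanes. -/
theorem ncard_le_of_surjectiveOnStalks {K V : Type u} [Field K] [AddCommGroup V] [Module K V]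
    [FiniteDimensional K V] (A : HypArr K V) {d : ℕ}
    (ψ : SymmetricAlgebra K (Module.Dual K V) →ₐ[K] AddMonoidAlgebra K (Fin d → ℤ))
    (hψ : ψ.toRingHom.SurjectiveOnStalks)
    (σ : AddMonoidAlgebra K (Fin d → ℤ) →+*
      FractionRing (SymmetricAlgebra K (Module.Dual K V)))
    (hσ : ∀ x, σ (ψ x) = algebraMap _ _ x)
    (hunit : ∀ H : A.planes, IsUnit (ψ (SymmetricAlgebra.ι K _ (A.form H)))) :
    A.planes.ncard ≤ Module.finrank K V := by
  let S := SymmetricAlgebra K (Module.Dual K V)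
  let L := FractionRing S
  have hinj : Function.Injective (algebraMap S L) := IsFractionRing.injective S L
  have hψinj : Function.Injective ψ := fun x y hxy => hinj (by rw [← hσ, ← hσ, hxy])
  -- At the prime `ker σ`, surjectivity on stalks writes `r` as a fraction `ψ x / ψ s`. If `σ r =
  -- 0`, then `x` vanishes in the fraction field, so `x = 0` and `r = 0`.
  have hσinj : Function.Injective σ := by
    rw [injective_iff_map_eq_zero]
    intro r hr
    have hsurj := hψ (RingHom.ker σ) (RingHom.ker_isPrime σ)
    rw [RingHom.surjective_localRingHom_iff] at hsurj
    obtain ⟨x, s, c, hc, hs, he⟩ := hsurj r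
    have hc0 : c ≠ 0 := fun h => hc (h ▸ Ideal.zero_mem _)
    rw [mul_assoc] at he
    have he := mul_left_cancel₀ hc0 he
    have hx : ψ x = 0 := by
      have h1 := congrArg σ he
      rw [map_mul, hr, mul_zero] at h1
      have h2 : algebraMap S L x = 0 := (hσ x).symm.trans h1.symm
      rw [(map_eq_zero_iff _ hinj).1 h2, map_zero]
    change ψ s * r = ψ x at he
    rw [hx] at he
    rcases mul_eq_zero.1 he with h | h
    · exact absurd (h ▸ Ideal.zero_mem _) hs
    · exact h
  let σ' : AddMonoidAlgebra K (Fin d → ℤ) →ₐ[K] L :=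
    { σ with
      commutes' := fun k => by
        change σ (algebraMap K _ k) = _
        rw [← ψ.commutes, hσ, ← IsScalarTower.algebraMap_apply] }
  -- Comparison of transcendence degrees: `d` independent variables embed in the function field of
  -- `V`.
  have hd : d ≤ Module.finrank K V := by
    obtain ⟨f, hf⟩ := exists_mvPolynomial_injective K d
    have h1 := trdeg_le_of_injective (σ'.comp f) (hσinj.comp hf)
    have h2 := trdeg_add_eq K S (A := L)
    have : Algebra.IsAlgebraic S L := IsLocalization.isAlgebraic L (nonZeroDivisors S)
    rw [trdeg_eq_zero (R := S), add_zero, SymmetricAlgebra.trdeg_eq_finrank] at h2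
    rw [← h2, MvPolynomial.trdeg_of_isDomain, Subspace.dual_finrank_eq] at h1
    rw [Cardinal.mk_fin, Cardinal.lift_natCast, Nat.cast_le] at h1
    exact h1
  choose a c hc ha using fun H => AddMonoidAlgebra.exists_eq_single_of_isUnit (hunit H)
  have := A.finite_planes.fintype
  have hli := linearIndependent_exponents ψ hψinj
    (fun H => SymmetricAlgebra.prime_ι (A.form_ne_zero H)) (fun H H' => A.eq_of_ι_dvd_ι) hc ha
  have hcard := hli.fintype_card_le_finrank
  rw [Module.finrank_fin_fun, ← Nat.card_eq_fintype_card, Nat.card_coe_set_eq] at hcard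
  exact hcard.trans hd

end HypArr

/-! ### Split tori: base change, self-torification, field-valued points -/

section Torus

open scoped AlgebraMonoidAlgebra in
/-- Group algebras are compatible with base change. -/
theorem isPushout_addMonoidAlgebra {R A : Type u} [CommRing R] [CommRing A] (f : R →+* A)
    (M : Type) [AddCommMonoid M] :
    IsPushout (CommRingCat.ofHom f)
      (CommRingCat.ofHom (algebraMap R (AddMonoidAlgebra R M)))
      (CommRingCat.ofHom (algebraMap A (AddMonoidAlgebra A M)))
      (CommRingCat.ofHom (AddMonoidAlgebra.mapRingHom M f)) := by
  let := f.toAlgebra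
  exact CommRingCat.isPushout_of_isPushout R A (AddMonoidAlgebra R M) (AddMonoidAlgebra A M)

/-- The split torus over the field `K`. -/
noncomputable abbrev torusOver (K : Type u) [Field K] (d : ℕ) : Scheme.{u} :=
  Spec (.of (AddMonoidAlgebra K (Fin d → ℤ)))

/-- The structure morphism of the split torus over `K`. -/
noncomputable abbrev torusOverStr (K : Type u) [Field K] (d : ℕ) : torusOver K d ⟶ Spec (.of K) :=
  Spec.map (CommRingCat.ofHom (algebraMap K (AddMonoidAlgebra K (Fin d → ℤ))))

/-- The split torus over `K` is the base change of the split torus over `ℤ`. -/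
theorem exists_isPullback_torus (K : Type u) [Field K] (d : ℕ) :
    ∃ r : torusOver K d ⟶ splitTorus.{u} d, IsPullback r (torusOverStr K d)
      (specULiftZIsTerminal.{u}.from _) (specULiftZIsTerminal.{u}.from (Spec (.of K))) := by
  have h := isPullback_SpecMap_of_isPushout _ _ _ _
    (isPushout_addMonoidAlgebra ((Int.castRingHom K).comp ULift.ringEquiv.{0, u}.toRingHom)
      (Fin d → ℤ)).flip
  -- Morphisms to the terminal scheme are unique, so the concrete structure maps may be swapped for
  -- the canonical ones.
  rw [specULiftZIsTerminal.{u}.hom_ext (Spec.map _) (specULiftZIsTerminal.from _),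
    specULiftZIsTerminal.{u}.hom_ext (Spec.map (CommRingCat.ofHom (RingHom.comp _ _)))
      (specULiftZIsTerminal.from _)] at h
  exact ⟨_, h⟩

/-- A split torus is torified by itself. -/
noncomputable def splitTorusTorification (d : ℕ) : Torification (splitTorus.{u} d) :=
  have hiso : IsIso (Sigma.ι (fun _ : PUnit.{u + 1} => splitTorus.{u} d) PUnit.unit) :=
    ⟨Sigma.desc fun _ => 𝟙 _, by simp, by ext; simp⟩
  have he : Sigma.ι (fun _ : PUnit.{u + 1} => splitTorus.{u} d) PUnit.unit ≫
      Sigma.desc (fun _ => 𝟙 _) = 𝟙 _ := by simp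
  have hiso' : IsIso (Sigma.desc fun _ : PUnit.{u + 1} => 𝟙 (splitTorus.{u} d)) :=
    IsIso.of_isIso_fac_left he
  { J := PUnit
    dim := fun _ => d
    e := Sigma.desc fun _ => 𝟙 _
    isImmersion := fun j => by
      rw [Sigma.ι_desc]
      infer_instance
    bijective := fun L _ =>
      ⟨fun p q h => (cancel_mono (Sigma.desc fun _ : PUnit.{u + 1} => 𝟙 (splitTorus.{u} d))).1 h,
        fun q => ⟨q ≫ inv (Sigma.desc fun _ : PUnit.{u + 1} => 𝟙 (splitTorus.{u} d)), by simp⟩⟩ }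

/-- A field-valued point of a disjoint union is a point of one of the members. -/
theorem exists_fac_sigma {J : Type u} (T : J → Scheme.{u}) {L : Type u} [Field L]
    (q : Spec (.of L) ⟶ ∐ T) : ∃ (j : J) (q' : Spec (.of L) ⟶ T j), q' ≫ Sigma.ι T j = q := by
  obtain ⟨j, y, hy⟩ := (sigmaOpenCover T).exists_eq (q (IsLocalRing.closedPoint L))
  have hr : Set.range q ⊆ Set.range (Sigma.ι T j) := by
    rintro _ ⟨x, rfl⟩
    rw [Subsingleton.elim x (IsLocalRing.closedPoint L)]
    exact ⟨y, hy⟩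
  exact ⟨j, IsOpenImmersion.lift (Sigma.ι T j) q hr, IsOpenImmersion.lift_fac _ _ _⟩

end Torus

/-! ### The complement as a scheme, and the bound from a torification -/

namespace HypArr

variable {K V : Type u} [Field K] [AddCommGroup V] [Module K V]

theorem mem_locus_iff (A : HypArr K V) (H : A.planes)
    (x : PrimeSpectrum (SymmetricAlgebra K (Module.Dual K V))) :
    x ∈ locus (H : Submodule K V) ↔ SymmetricAlgebra.ι K _ (A.form H) ∈ x.asIdeal := by
  rw [locus, PrimeSpectrum.mem_zeroLocus]
  constructor
  · intro h
    exact h ⟨A.form H, (ker_form A H).ge, rfl⟩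
  · rintro h _ ⟨φ, hφ, rfl⟩
    -- All forms vanishing on a hyperplane are multiples of a single one.
    have hspan : φ ∈ Submodule.span K {A.form H} := by
      have : φ ∈ Submodule.span K (Set.range fun _ : Unit => A.form H) := by
        refine mem_span_of_iInf_ker_le_ker ?_
        rw [iInf_const, ker_form]
        exact hφ
      rwa [Set.range_const] at this
    obtain ⟨c, rfl⟩ := Submodule.mem_span_singleton.1 hspan
    rw [map_smul, Algebra.smul_def]
    exact Ideal.mul_mem_left _ _ h

theorem mem_complementOpens_iff (A : HypArr K V) 
    (x : PrimeSpectrum (SymmetricAlgebra K (Module.Dual K V))) :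
    (show affineSpace K V from x) ∈ A.complementOpens ↔ ∀ H : A.planes, SymmetricAlgebra.ι K _ (A.form H) ∉ x.asIdeal := by
  change x ∈ (⋃ H ∈ A.planes, locus H)ᶜ ↔ _
  constructor
  · intro h H hH
    exact h (Set.mem_iUnion₂.2 ⟨H, H.2, (A.mem_locus_iff H x).2 hH⟩)
  · intro h hx
    obtain ⟨H, hH, hx⟩ := Set.mem_iUnion₂.1 hx
    exact h ⟨H, hH⟩ ((A.mem_locus_iff ⟨H, hH⟩ x).1 hx)

end HypArr

theorem IsFractionRing.eq_zero_of_mem_prime {S L : Type*} [CommRing S] [IsDomain S] [CommRing L]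
    [Algebra S L] [IsFractionRing S L] (I : Ideal L) (hI : I ≠ ⊤) {s : S}
    (hs : algebraMap S L s ∈ I) : s = 0 := by
  by_contra h
  exact hI (Ideal.eq_top_of_isUnit_mem _ hs
    (IsLocalization.map_units L (⟨s, mem_nonZeroDivisors_of_ne_zero h⟩ : nonZeroDivisors S)))

namespace HypArr

variable {K V : Type u} [Field K] [AddCommGroup V] [Module K V]

/-- The generic point of the affine space lies in the complement of the arrangement. -/
theorem range_genericPoint_subset (A : HypArr K V) :
    Set.range (Spec.map (CommRingCat.ofHom (algebraMap
      (SymmetricAlgebra K (Module.Dual K V))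
      (FractionRing (SymmetricAlgebra K (Module.Dual K V)))))) ⊆
      Set.range A.complementOpens.ι := by
  rw [Scheme.Opens.range_ι]
  rintro _ ⟨x, rfl⟩
  refine (A.mem_complementOpens_iff _).2 fun H hH => ?_
  exact (SymmetricAlgebra.prime_ι (A.form_ne_zero H)).ne_zero
    (IsFractionRing.eq_zero_of_mem_prime
      (L := FractionRing (SymmetricAlgebra K (Module.Dual K V))) _ x.isPrime.ne_top hH)

theorem ncard_le_of_hasTorification [FiniteDimensional K V] {A : HypArr K V}
    (hA : A.HasTorification) : A.planes.ncard ≤ Module.finrank K V := by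
  obtain ⟨X, ⟨T⟩, f, hf⟩ := hA
  let gen := IsOpenImmersion.lift A.complementOpens.ι _ A.range_genericPoint_subset
  have hgen : gen ≫ A.complementOpens.ι = _ :=
    IsOpenImmersion.lift_fac A.complementOpens.ι _ A.range_genericPoint_subset
  -- Only surjectivity is used, and only over the fraction field of the ring of polynomial
  -- functions: it lifts the generic point to the tori.
  obtain ⟨q, hq⟩ := (T.bijective _).2 (gen ≫ f.inv ≫ pullback.fst _ _)
  obtain ⟨j, q', rfl⟩ := exists_fac_sigma _ q
  have himm := T.isImmersion j
  set i := Sigma.ι (fun j => splitTorus.{u} (T.dim j)) j ≫ T.e with hi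
  have hq' : q' ≫ i = gen ≫ f.inv ≫ pullback.fst _ _ := by
    rw [hi, ← Category.assoc]
    exact hq
  obtain ⟨r, hr⟩ := exists_isPullback_torus K (T.dim j)
  have t : IsPullback (pullback.fst _ _) (baseChangeStr X K) (specULiftZIsTerminal.{u}.from X)
    (specULiftZIsTerminal.{u}.from (Spec (.of K))) := IsPullback.of_hasPullback _ _
  have hr' : IsPullback (torusOverStr K (T.dim j)) r
      (specULiftZIsTerminal.{u}.from (Spec (.of K)))
      (i ≫ specULiftZIsTerminal.{u}.from X) := by
    rw [specULiftZIsTerminal.{u}.hom_ext (i ≫ _) (specULiftZIsTerminal.{u}.from _)]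
    exact hr.flip
  -- Pasting pullbacks exhibits the map of K-tori as a base change of `i`, so it is again an
  -- immersion.
  have hiK := IsPullback.of_right' hr' t.flip
  have hK1 := t.flip.lift_fst (torusOverStr K (T.dim j)) (r ≫ i)
    (specULiftZIsTerminal.{u}.hom_ext _ _)
  have hK2 := t.flip.lift_snd (torusOverStr K (T.dim j)) (r ≫ i)
    (specULiftZIsTerminal.{u}.hom_ext _ _)
  set iK := t.flip.lift (torusOverStr K (T.dim j)) (r ≫ i)
    (specULiftZIsTerminal.{u}.hom_ext _ _)
  have hiKimm : IsImmersion iK := MorphismProperty.of_isPullback (P := @IsImmersion) hiK.flip himm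
  -- The lifted generic point, now a point of the torus over `K`; on rings it becomes the map `σ` to
  -- the fraction field.
  let sK := hr.lift q' (gen ≫ A.complementStr) (specULiftZIsTerminal.{u}.hom_ext _ _)
  have hs1 : sK ≫ r = q' := hr.lift_fst _ _ _
  have hs2 : sK ≫ torusOverStr K (T.dim j) = gen ≫ A.complementStr := hr.lift_snd _ _ _
  have hsK : sK ≫ iK = gen ≫ f.inv := by
    refine t.hom_ext ?_ ?_
    · rw [Category.assoc, hK2, ← Category.assoc, hs1, hq', Category.assoc]
    · rw [Category.assoc, hK1, hs2, Category.assoc, ← hf, Iso.inv_hom_id_assoc]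
  let g : torusOver K (T.dim j) ⟶ affineSpace K V := (iK ≫ f.hom) ≫ A.complementOpens.ι
  have hgs : sK ≫ g = Spec.map (CommRingCat.ofHom (algebraMap _ _)) := by
    rw [← hgen]
    simp only [g, ← Category.assoc]
    rw [hsK, Category.assoc gen, Iso.inv_hom_id, Category.comp_id]
  have hgstr : g ≫ Spec.map (CommRingCat.ofHom
      (algebraMap K (SymmetricAlgebra K (Module.Dual K V)))) = torusOverStr K (T.dim j) := by
    rw [← hK1, ← hf]
    simp only [g, Category.assoc]
  have hgimm : IsImmersion g := inferInstance
  obtain ⟨ψ, hψ⟩ := Spec.map_surjective g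
  obtain ⟨σ, hσ⟩ := Spec.map_surjective sK
  have hψK : ∀ k, ψ.hom (algebraMap K _ k) = algebraMap K _ k := by
    intro k
    rw [← hψ, ← Spec.map_comp] at hgstr
    exact congrArg (fun φ => φ.hom k) (Spec.map_injective hgstr)
  have hσψ : ∀ x, σ.hom (ψ.hom x) = algebraMap _ _ x := by
    intro x
    rw [← hψ, ← hσ, ← Spec.map_comp] at hgs
    exact congrArg (fun φ => φ.hom x) (Spec.map_injective hgs)
  refine A.ncard_le_of_surjectiveOnStalks
    (ψ := { ψ.hom with commutes' := hψK }) ?_ σ.hom hσψ fun H => ?_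
  · have : SurjectiveOnStalks (Spec.map ψ) := by rw [hψ]; infer_instance
    exact SurjectiveOnStalks.Spec_iff.1 this
  -- A non-unit would vanish at some point of the torus, whose image would then lie on the
  -- hyperplane `H`.
  · by_contra hu
    obtain ⟨M, hM, hmem⟩ := exists_max_ideal_of_mem_nonunits hu
    let x : torusOver K (T.dim j) := ⟨M, hM.isPrime⟩
    have hx : g x ∈ A.complementOpens := by
      have : g x ∈ Set.range A.complementOpens.ι := ⟨(iK ≫ f.hom) x, by
        rw [← Scheme.Hom.comp_apply]⟩
      rwa [Scheme.Opens.range_ι] at this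
    rw [← hψ] at hx
    exact (A.mem_complementOpens_iff _).1 hx H hmem

end HypArr

/-! ### The complement of coordinate hyperplanes is a split torus -/

theorem monoidHom_ext_single {n : ℕ} {G : Type*} [CommGroup G]
    {f g : Multiplicative (Fin n → ℤ) →* G}
    (h : ∀ i, f (Multiplicative.ofAdd (Pi.single i 1)) = g (Multiplicative.ofAdd (Pi.single i 1))) :
    f = g := by
  refine MonoidHom.ext fun a => ?_
  have ha : a = ∏ i, Multiplicative.ofAdd (Pi.single i (1 : ℤ)) ^ Multiplicative.toAdd a i := by
    apply Multiplicative.toAdd.injective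
    funext j
    simp [toAdd_prod, Finset.sum_apply, Pi.single_apply]
  rw [ha, map_prod, map_prod]
  simp only [map_zpow, h]

/-- Inverting the coordinates of a polynomial ring gives the Laurent polynomial ring. -/
theorem nonempty_localizationAway_algEquiv {K W : Type*} [Field K] [AddCommGroup W] [Module K W]
    {n : ℕ} (b : Module.Basis (Fin n) K W) :
    Nonempty (Localization.Away (∏ i, SymmetricAlgebra.ι K W (b i)) ≃ₐ[K]
      AddMonoidAlgebra K (Fin n → ℤ)) := by
  classical
  let S := SymmetricAlgebra K W
  let F : S := ∏ i, SymmetricAlgebra.ι K W (b i)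
  let Q := Localization.Away F
  let R := AddMonoidAlgebra K (Fin n → ℤ)
  let mon : Multiplicative (Fin n → ℤ) →* Rˣ :=
    (AddMonoidAlgebra.of K (Fin n → ℤ)).toHomUnits
  have hmon : ∀ a, (mon (Multiplicative.ofAdd a) : R) = AddMonoidAlgebra.single a 1 :=
    fun _ => rfl
  let φ₀ : S →ₐ[K] R := SymmetricAlgebra.lift
    (b.constr K fun i => (mon (Multiplicative.ofAdd (Pi.single i 1)) : R))
  have hφ₀ : ∀ i, φ₀ (SymmetricAlgebra.ι K W (b i)) =
      mon (Multiplicative.ofAdd (Pi.single i 1)) := by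
    intro i
    rw [SymmetricAlgebra.lift_ι_apply, Module.Basis.constr_basis]
  have hF : IsUnit (φ₀ F) := by
    rw [map_prod]
    exact IsUnit.prod_univ_iff.2 fun i => by rw [hφ₀]; exact Units.isUnit _
  let φ : Q →ₐ[K] R := IsLocalization.liftAlgHom (M := Submonoid.powers F) (f := φ₀) (by
    rintro ⟨_, m, rfl⟩
    rw [map_pow]
    exact hF.pow m)
  have hφ : ∀ s : S, φ (algebraMap S Q s) = φ₀ s := fun s => IsLocalization.lift_eq _ s
  have hu : ∀ i, IsUnit (algebraMap S Q (SymmetricAlgebra.ι K W (b i))) := fun i =>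
    isUnit_of_dvd_unit (map_dvd _ (Finset.dvd_prod_of_mem (fun i => SymmetricAlgebra.ι K W (b i))
      (Finset.mem_univ i))) (IsLocalization.Away.algebraMap_isUnit F)
  choose w hw using hu
  -- The inverse on monomials: `a` goes to the product of the `w i ^ a i`, written additively in the
  -- unit group.
  let γ : Multiplicative (Fin n → ℤ) →* Qˣ := AddMonoidHom.toMultiplicativeLeft
    (∑ i, ((zmultiplesHom (Additive Qˣ) (Additive.ofMul (w i))).comp
      (Pi.evalAddMonoidHom (fun _ : Fin n => ℤ) i)))
  have hγ : ∀ i, γ (Multiplicative.ofAdd (Pi.single i 1)) = w i := by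
    intro i
    change Additive.toMul ((∑ j, ((zmultiplesHom (Additive Qˣ) (Additive.ofMul (w j))).comp
      (Pi.evalAddMonoidHom (fun _ : Fin n => ℤ) j))) (Pi.single i 1)) = w i
    rw [AddMonoidHom.finsetSum_apply, Finset.sum_eq_single i]
    · simp
    · intro j _ hj
      simp [Pi.single_eq_of_ne hj]
    · simp
  let ψ : R →ₐ[K] Q := AddMonoidAlgebra.lift K Q (Fin n → ℤ) ((Units.coeHom Q).comp γ)
  have hψ : ∀ a, ψ (AddMonoidAlgebra.single a 1) = γ (Multiplicative.ofAdd a) := by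
    intro a
    rw [AddMonoidAlgebra.lift_single, one_smul]
    rfl
  have hcomp : (Units.map (φ : Q →* R)).comp γ = mon := by
    refine monoidHom_ext_single fun i => Units.ext ?_
    rw [MonoidHom.comp_apply, hγ, ← hφ₀, ← hφ, ← hw]
    rfl
  refine ⟨AlgEquiv.ofAlgHom φ ψ ?_ ?_⟩
  · refine AddMonoidAlgebra.algHom_ext (fun a => ?_) (by ext)
    rw [AlgHom.comp_apply, hψ, AlgHom.id_apply]
    exact congrArg Units.val (DFunLike.congr_fun hcomp (Multiplicative.ofAdd a))
  · refine IsLocalization.algHom_ext (Submonoid.powers F) ?_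
    refine SymmetricAlgebra.algHom_ext (b.ext fun i => ?_)
    change ψ (φ (algebraMap S Q (SymmetricAlgebra.ι K W (b i)))) =
      algebraMap S Q (SymmetricAlgebra.ι K W (b i))
    rw [hφ, hφ₀, hmon, hψ, hγ, hw]

namespace HypArr

variable {K V : Type u} [Field K] [AddCommGroup V] [Module K V]

/-- The forms are a basis of the dual, so the complement is the basic open set of their product, a
split torus over `K`; the integral torus of the same rank is the required model. -/
theorem hasTorification_of_ncard_eq [FiniteDimensional K V] {A : HypArr K V}
    (h : sInf A.planes = ⊥) (hc : A.planes.ncard = Module.finrank K V) : A.HasTorification := by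
  have := A.finite_planes.fintype
  let n := Fintype.card A.planes
  let ε := Fintype.equivFin A.planes
  let b := (formBasis h hc).reindex ε
  have hb : ∀ i, b i = A.form (ε.symm i) := fun i => by
    rw [Module.Basis.reindex_apply, formBasis_apply]
  let F := ∏ i, SymmetricAlgebra.ι K (Module.Dual K V) (b i)
  obtain ⟨e⟩ := nonempty_localizationAway_algEquiv b
  let loc : Spec (.of (Localization.Away F)) ⟶ affineSpace K V :=
    Spec.map (CommRingCat.ofHom (algebraMap _ _))
  let c : torusOver K n ≅ Spec (.of (Localization.Away F)) :=
    Scheme.Spec.mapIso e.toRingEquiv.toCommRingCatIso.op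
  have hloc : IsOpenImmersion loc := inferInstanceAs (IsOpenImmersion (Spec.map _))
  have hrange : Set.range (c.hom ≫ loc) = Set.range A.complementOpens.ι := by
    have h1 : Set.range (c.hom ≫ loc) = Set.range loc := by
      rw [Scheme.Hom.comp_base, TopCat.coe_comp, Set.range_comp, c.hom.surjective.range_eq,
        Set.image_univ]
    rw [Scheme.Opens.range_ι, h1]
    refine (PrimeSpectrum.localization_away_comap_range (Localization.Away F) F).trans ?_
    ext x
    refine Iff.trans ?_ (A.mem_complementOpens_iff x).symm
    -- A prime contains the product exactly when it contains one of the forms, so inverting `F`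
    -- removes precisely the hyperplanes.
    rw [SetLike.mem_coe, PrimeSpectrum.mem_basicOpen, Ideal.IsPrime.prod_mem_iff]
    simp only [Finset.mem_univ, true_and, not_exists, hb]
    exact ⟨fun h H => by simpa using h (ε H), fun h i => h _⟩
  let ι' : torusOver K n ≅ A.complement :=
    IsOpenImmersion.isoOfRangeEq (c.hom ≫ loc) A.complementOpens.ι hrange
  have hι' : ι'.hom ≫ A.complementStr = torusOverStr K n := by
    have h1 : ι'.hom ≫ A.complementOpens.ι = c.hom ≫ loc :=
      IsOpenImmersion.isoOfRangeEq_hom_fac _ _ hrange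
    rw [complementStr, ← Category.assoc, h1, Category.assoc]
    change Spec.map _ ≫ Spec.map _ ≫ Spec.map _ = Spec.map _
    rw [← Spec.map_comp, ← Spec.map_comp]
    refine congrArg Spec.map (CommRingCat.hom_ext (RingHom.ext fun k => ?_))
    change e (algebraMap _ (Localization.Away F) (algebraMap K _ k)) = algebraMap K _ k
    rw [← IsScalarTower.algebraMap_apply, e.commutes]
  obtain ⟨r, hr⟩ := exists_isPullback_torus K n
  refine ⟨splitTorus n, ⟨splitTorusTorification n⟩, hr.isoPullback.symm ≪≫ ι', ?_⟩
  rw [Iso.trans_hom, Category.assoc, hι']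
  exact hr.isoPullback_inv_snd

end HypArr

theorem theorem4p3 {α : Type*} {β : Type u} (Γ : Graph α β) [Finite V(Γ)] [Finite E(Γ)]
    (o : Γ.EdgeOrientation) (K : Type u) [Field K] :
    List.TFAE
      [(o.arrangement K).HasTorification,
       (o.arrangement K).IsBoolean,
       (o.arrangement K).planes.ncard = o.b1 K,
       ∀ F : Set E(Γ), o.IsSpanningForest F → o.IsSeparated K (o.fundamentalBasis K F),
       ∃ F : Set E(Γ), o.IsSpanningForest F ∧ o.IsSeparated K (o.fundamentalBasis K F),
       ∃ B : Set (o.H1 K), o.IsSimpleCycleBasis K B ∧ o.IsSeparated K B] := by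
  have hess := Graph.EdgeOrientation.sInf_planes_arrangement (o := o) (K := K)
  tfae_have 1 → 3 := fun h =>
    le_antisymm (HypArr.ncard_le_of_hasTorification h) (HypArr.finrank_le_ncard hess)
  tfae_have 3 → 1 := fun h => HypArr.hasTorification_of_ncard_eq hess h
  tfae_have 2 ↔ 3 := HypArr.isBoolean_iff hess
  tfae_have 3 → 4 := fun h F hF => Graph.EdgeOrientation.isSeparated_fundamentalBasis h hF
  tfae_have 4 → 5 := fun h =>
    let ⟨F, hF⟩ := o.exists_isSpanningForest
    ⟨F, hF, h F hF⟩
  tfae_have 5 → 6 := fun ⟨F, hF, hs⟩ => ⟨_, hF.isSimpleCycleBasis, hs⟩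
  tfae_have 6 → 3 := fun ⟨B, hB, hs⟩ =>
    Graph.EdgeOrientation.ncard_planes_of_isSeparated hB hs
  tfae_finish
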